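/- **QBF encoding.** Let $f\colon\{0,1\}^n\to\{0,1\}$ be a Boolean function and let $C$ be a Boolean circuit computing $f$, with gates $1,\dots,s$ of types $\neg,\wedge,\vee$ (fan-in at most two) and constants. Take variables $X=\{x_1,\dots,x_n\}$, $u$, and $Y=\{y_1,\dots,y_s\}$, one $y_j$ for each gate. Let $\varphi(X,u,Y)$ be the Tseitin CNF of $C$: for each gate $j$ the usual clauses expressing that $y_j$ equals the value of gate $j$ on its inputs, together with the clauses $o\vee u$ and $\neg o\vee\neg u$, where $o$ is the variable of the output of $C$. (So $\exists Y\,\varphi(X,u,Y)$ is equivalent to $C(X)\neq u$.) The QBF $\Phi=\exists X\,\forall u\,\exists Y.\ \varphi(X,u,Y)$ is called a *QBF encoding* of $f$. The size of a QBF is its number of variables plus its number of clauses plus the total number of literal occurrences. **Merge Resolution (MRes).** Let $\Phi=Q\cdot\varphi$ be a prenex QBF with CNF matrix $\varphi$, existential variables $X_\exists$ and universal variables $U$. A merge map for $u\in U$ is a non-empty finite set of line numbers (natural numbers), each carrying an instruction that is either a value in $\{*,0,1\}$ or of the form "if $x=0$ go to line $a$ else go to line $b$", where $a,b$ are smaller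 line numbers of the map and $x\in X_\exists$ is left of $u$ in $Q$. Its leading instruction is the one with the largest number. It is trivial if it is a single instruction with value $*$. Two merge maps are consistent if they agree on all common line numbers, and isomorphic ($\simeq$) if a bijection of line numbers transforms one into the other. A line of a proof is a clause over $X_\exists$ together with a merge map $M^u$ for each $u\in U$. Lines are derived as follows. 1. From a clause $A\in\varphi$ and $i\in\mathbb N$: the existential part of $A$, where each $M^u$ is the single instruction $\langle i\rangle : b_u$, with $b_u$ the value of $u$ that falsifies $A$, or $b_u=*$ if $u$ does not occur in $A$. 2. From $(C_0,\{M_0^u\})$ and $(C_1,\{M_1^u\})$ with $x\in C_0$ and $\neg x\in C_1$, $x\in X_\exists$ (the pivot): the clause $(C_0\setminus\{x\})\cup(C_1\setminus\{\neg x\})$, where for each $u\in U$ one of the following holds: $M^u_a$ is trivial and $M^u=M^u_{1-a}$ for some $a\in\{0,1\}$; or $M^u=M^u_0\simeq M^u_1$; or $x$ is left of $u$, $M_0^u$ and $M_1^u$ are consistent, and $M^u$ is their union together with a new leading instruction "if $x=0$ go to the leading instruction of $M^u_0$ else go to that of $M^u_1$". A refutation is a sequence of lines, each derived from earlier ones,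 whose last line has the empty clause; its size is its number of lines. It is *regular* if on every path of its derivation graph from a leaf (a line derived by rule 1) to the last line, each existential variable is used as pivot at most once. **Statement.** There are Boolean functions $f_n\colon\{0,1\}^n\to\{0,1\}$ $(n\in\mathbb N)$ and QBF encodings $\Phi_n$ of $f_n$ whose size is bounded by a polynomial in $n$, such that every regular MRes refutation of $\Phi_n$ has size $2^{\Omega(\sqrt n)}$; that is, there are $c>0$ and $n_0$ such that for all $n\ge n_0$ every regular MRes refutation of $\Phi_n$ has at least $2^{c\sqrt n}$ lines. -/

import Mathlib

/-- A literal over the variables `V`: `(v, true)` is `v` and `(v, false)` is `¬v`. -/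
abbrev Lit (V : Type) : Type := V × Bool

/-- A clause is a finite set of literals, read as their disjunction. -/
abbrev Clause (V : Type) : Type := Finset (Lit V)

/-- The two quantifiers `∃` and `∀`. -/
inductive Quantifier where
  | ex
  | all
  deriving DecidableEq

/-- Quantified Boolean formulas in prenex conjunctive normal form.  The prefix is a list of
pairwise disjoint blocks of variables with alternating quantifiers, the matrix is a finite set of
clauses over the quantified variables. -/
structure QBF (V : Type) where
  blocks : List (Quantifier × Finset V)
  matrix : Finset (Clause V)
  disjoint : blocks.Pairwise (fun B B' => Disjoint B.2 B'.2)
  alternating : blocks.IsChain (fun B B' => B.1 ≠ B'.1)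
  closed : ∀ C ∈ matrix, ∀ l ∈ C, ∃ B ∈ blocks, l.1 ∈ B.2

namespace QBF

variable {V : Type} [DecidableEq V]

/-- The variables bound by the quantifier `q`. -/
def varsOf (Φ : QBF V) (q : Quantifier) : Finset V :=
  ((Φ.blocks.filter (fun B => B.1 = q)).map Prod.snd).foldr (· ∪ ·) ∅

/-- The set `X` of existential variables. -/
def existVars (Φ : QBF V) : Finset V := Φ.varsOf .ex

/-- The set `U` of universal variables. -/
def univVars (Φ : QBF V) : Finset V := Φ.varsOf .all

/-- `z` is left of `z'` in the prefix, i.e. it lies in a strictly earlier block. -/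
def Precedes (Φ : QBF V) (z z' : V) : Prop :=
  ∃ i j : Fin Φ.blocks.length, i < j ∧ z ∈ (Φ.blocks.get i).2 ∧ z' ∈ (Φ.blocks.get j).2

open Classical in
/-- `L_Q(u)`, the set of existential variables left of `u`. -/
noncomputable def left (Φ : QBF V) (u : V) : Finset V :=
  Φ.existVars.filter (fun x => Φ.Precedes x u)

/-- The size: the number of variables in the prefix, plus the number of clauses, plus the total
number of literal occurrences. -/
def size (Φ : QBF V) : ℕ :=
  (Φ.blocks.map (fun B => B.2.card)).sum + ∑ C ∈ Φ.matrix, (C.card + 1)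

end QBF

/-! ### Merge maps -/

/-- Instructions of a merge map: either output a value in `{*, 0, 1}` (with `none` for `*`), or
"if `x = 0` then go to line `a` else go to line `b`". -/
inductive Instr (V : Type) where
  | out (b : Option Bool)
  | query (x : V) (a b : ℕ)

/-- Renaming of the line numbers in an instruction. -/
def Instr.relabel {V : Type} (σ : ℕ → ℕ) : Instr V → Instr V
  | .out b => .out b
  | .query x a b => .query x (σ a) (σ b)

/-- A merge map that may query the variables in `S`: a non-empty finite set `dom` of line numbers,
with an instruction on each of them (and on no other number), such that each query refers to
smaller line numbers of the merge map only. -/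
structure MergeMap {V : Type} (S : Finset V) where
  dom : Finset ℕ
  instr : ℕ → Option (Instr V)
  mem_dom : ∀ i, i ∈ dom ↔ instr i ≠ none
  nonempty : dom.Nonempty
  query_mem : ∀ i x a b, instr i = some (.query x a b) →
    x ∈ S ∧ a ∈ dom ∧ b ∈ dom ∧ a < i ∧ b < i

namespace MergeMap

variable {V : Type} {S : Finset V}

/-- The line number of the leading instruction. -/
def top (M : MergeMap S) : ℕ := M.dom.max' M.nonempty

/-- The simple merge map with the single instruction `⟨i⟩ : b`. -/
def simple (S : Finset V) (i : ℕ) (b : Option Bool) : MergeMap S where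
  dom := {i}
  instr := fun k => if k = i then some (.out b) else none
  mem_dom := by intro k; by_cases h : k = i <;> simp [h]
  nonempty := ⟨i, by simp⟩
  query_mem := by
    intro k x a c h
    by_cases hk : k = i <;> simp [hk] at h

/-- A merge map is trivial if it consists of a single instruction with the value `*`. -/
def IsTrivial (M : MergeMap S) : Prop := ∃ i, M = simple S i none

/-- The merge maps have identical instructions at all common line numbers. -/
def Consistent (M₀ M₁ : MergeMap S) : Prop :=
  ∀ i ∈ M₀.dom, i ∈ M₁.dom → M₀.instr i = M₁.instr i

/-- There is a bijection between the line numbers that transforms `M₀` into `M₁`. -/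
def Isomorphic (M₀ M₁ : MergeMap S) : Prop :=
  ∃ σ : ℕ → ℕ, Set.BijOn σ M₀.dom M₁.dom ∧
    ∀ i ∈ M₀.dom, M₁.instr (σ i) = (M₀.instr i).map (Instr.relabel σ)

/-- `M` consists of the instructions of the consistent merge maps `M₀` and `M₁`, and of a new
leading instruction "if `x = 0` then go to the leading instruction of `M₀` else go to the leading
instruction of `M₁`". -/
def IsMerge (x : V) (M₀ M₁ M : MergeMap S) : Prop :=
  Consistent M₀ M₁ ∧
  ∃ ℓ : ℕ, (∀ i ∈ M₀.dom ∪ M₁.dom, i < ℓ) ∧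
    M.dom = insert ℓ (M₀.dom ∪ M₁.dom) ∧
    M.instr ℓ = some (.query x M₀.top M₁.top) ∧
    (∀ i ∈ M₀.dom, M.instr i = M₀.instr i) ∧
    (∀ i ∈ M₁.dom, M.instr i = M₁.instr i)

end MergeMap

/-! ### Merge Resolution -/

section MergeResolution

variable {V : Type} [DecidableEq V]

/-- A line of a Merge Resolution proof: a clause and a merge map for each universal variable. -/
structure MLine (Φ : QBF V) where
  clause : Clause V
  map : (u : Φ.univVars) → MergeMap (Φ.left u)

/-- `b` is the value that the variable `u` has to take to falsify the clause `A`, with `none`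
(that is, `*`) if `u` does not occur in `A`. -/
def IsFalsifyingValue (A : Clause V) (u : V) : Option Bool → Prop
  | none => (u, true) ∉ A ∧ (u, false) ∉ A
  | some c => (u, !c) ∈ A ∧ (u, c) ∉ A

/-- The line `L` is obtained by downloading the clause `A` of the matrix. -/
def IsInitialLine (Φ : QBF V) (A : Clause V) (L : MLine Φ) : Prop :=
  A ∈ Φ.matrix ∧
  L.clause = A.filter (fun l => l.1 ∈ Φ.existVars) ∧
  ∃ i : ℕ, ∀ u : Φ.univVars, ∃ b : Option Bool,
    IsFalsifyingValue A u b ∧ L.map u = MergeMap.simple (Φ.left u) i b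

/-- The line `L` follows from `L₀` and `L₁` by the resolution rule with pivot `x`, where `x` occurs
positively in `L₀` and negatively in `L₁`. -/
def IsResolvent (Φ : QBF V) (x : V) (L₀ L₁ L : MLine Φ) : Prop :=
  x ∈ Φ.existVars ∧
  (x, true) ∈ L₀.clause ∧ (x, false) ∈ L₁.clause ∧
  L.clause = L₀.clause.erase (x, true) ∪ L₁.clause.erase (x, false) ∧
  ∀ u : Φ.univVars,
    ((L₀.map u).IsTrivial ∧ L.map u = L₁.map u) ∨
    ((L₁.map u).IsTrivial ∧ L.map u = L₀.map u) ∨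
    ((L₀.map u).Isomorphic (L₁.map u) ∧ L.map u = L₀.map u) ∨
    (Φ.Precedes x u ∧ (L₀.map u).IsMerge x (L₁.map u) (L.map u))

/-- Justification of one of the lines `0, …, m - 1` of a proof: a downloaded clause, or a resolution
step with pivot `x` whose antecedents are the lines `a` (containing `x`) and `b` (containing
`¬x`). -/
inductive Justification (V : Type) (m : ℕ) where
  | initial (A : Clause V)
  | res (x : V) (a b : Fin m)

/-- The pivot of a resolution step. -/
def Justification.pivot {V : Type} {m : ℕ} : Justification V m → Option V
  | .initial _ => none
  | .res x _ _ => some x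

/-- `a` is one of the antecedents of the step. -/
def Justification.HasAntecedent {V : Type} {m : ℕ} : Justification V m → Fin m → Prop
  | .initial _, _ => False
  | .res _ a b, c => c = a ∨ c = b

/-- A Merge Resolution refutation of `Φ`: a sequence of lines `0, …, last`, each with its
justification from earlier lines, such that the clause of the last line is empty. -/
structure MResRefutation (Φ : QBF V) where
  last : ℕ
  line : Fin (last + 1) → MLine Φ
  just : Fin (last + 1) → Justification V (last + 1)
  valid : ∀ i, match just i with
    | .initial A => IsInitialLine Φ A (line i)
    | .res x a b => a < i ∧ b < i ∧ IsResolvent Φ x (line a) (line b) (line i)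
  last_empty : (line (Fin.last last)).clause = ∅

namespace MResRefutation

variable {Φ : QBF V}

/-- The size of a refutation is its number of lines. -/
def size (R : MResRefutation Φ) : ℕ := R.last + 1

/-- `p` is a path of the derivation graph from a leaf (a line that downloads a clause of the matrix)
to the root (the last line); edges go from antecedents to consequents. -/
def IsLeafToRootPath (R : MResRefutation Φ) (p : List (Fin (R.last + 1))) : Prop :=
  p.IsChain (fun a c => (R.just c).HasAntecedent a) ∧
  (∃ i A, p.head? = some i ∧ R.just i = .initial A) ∧
  p.getLast? = some (Fin.last R.last)

/-- `S`-regularity: no leaf-to-root path uses a variable of `S` more than once as pivot. -/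
def IsRegularOn (R : MResRefutation Φ) (S : Finset V) : Prop :=
  ∀ x ∈ S, ∀ p, R.IsLeafToRootPath p → (p.map (fun i => (R.just i).pivot)).count (some x) ≤ 1

/-- A refutation is regular if it is regular on the set of all existential variables. -/
def IsRegular (R : MResRefutation Φ) : Prop := R.IsRegularOn Φ.existVars

end MResRefutation

end MergeResolution

/-! ### Boolean circuits -/

/-- A gate of fan-in at most two whose inputs are taken from `W`. -/
inductive Gate (W : Type) where
  | const (b : Bool)
  | not (a : W)
  | and (a b : W)
  | or (a b : W)

/-- The value of a gate, given the values of its inputs. -/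
def Gate.eval {W : Type} (v : W → Bool) : Gate W → Bool
  | .const b => b
  | .not a => !v a
  | .and a b => v a && v b
  | .or a b => v a || v b

/-- A sequence of `s` gates, where the inputs of each gate are circuit inputs (`n` of them) or
earlier gates. -/
inductive GateSeq (n : ℕ) : ℕ → Type where
  | nil : GateSeq n 0
  | snoc {s : ℕ} (P : GateSeq n s) (g : Gate (Fin n ⊕ Fin s)) : GateSeq n (s + 1)

/-- The values of all gates on a given input. -/
def GateSeq.val {n : ℕ} (α : Fin n → Bool) : {s : ℕ} → GateSeq n s → Fin s → Bool
  | _, .nil => Fin.elim0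
  | _, .snoc P g => Fin.snoc (α := fun _ => Bool) (P.val α) (g.eval (Sum.elim α (P.val α)))

/-- A Boolean circuit with `n` inputs; its output is one of its gates or one of its inputs. -/
structure Circuit (n : ℕ) where
  size : ℕ
  gates : GateSeq n size
  output : Fin n ⊕ Fin size

/-- The Boolean function computed by a circuit. -/
def Circuit.eval {n : ℕ} (C : Circuit n) (α : Fin n → Bool) : Bool :=
  Sum.elim α (C.gates.val α) C.output

/-! ### The Tseitin encoding -/

/-- The variables of the encoding: inputs `x i`, the universal variable `u`, and a variable `y j`
for the `j`-th gate. -/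
inductive EncVar (n : ℕ) where
  | x (i : Fin n)
  | u
  | y (j : ℕ)
  deriving DecidableEq

/-- The variable that stands for an input or a gate. -/
def wireVar {n s : ℕ} : Fin n ⊕ Fin s → EncVar n
  | .inl i => .x i
  | .inr j => .y j

/-- The clauses saying that the variable `z` has the value of the gate. -/
def Gate.tseitin {n s : ℕ} (z : EncVar n) : Gate (Fin n ⊕ Fin s) → Finset (Clause (EncVar n))
  | .const b => {{(z, b)}}
  | .not a => {{(z, true), (wireVar a, true)}, {(z, false), (wireVar a, false)}}
  | .and a b => {{(z, false), (wireVar a, true)}, {(z, false), (wireVar b, true)},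
      {(z, true), (wireVar a, false), (wireVar b, false)}}
  | .or a b => {{(z, true), (wireVar a, false)}, {(z, true), (wireVar b, false)},
      {(z, false), (wireVar a, true), (wireVar b, true)}}

/-- The clauses saying that every gate variable has the value of its gate. -/
def GateSeq.tseitin {n : ℕ} : {s : ℕ} → GateSeq n s → Finset (Clause (EncVar n))
  | _, .nil => ∅
  | _, .snoc (s := s) P g => P.tseitin ∪ g.tseitin (.y s)

/-- The Tseitin formula `φ(X, u, Y)`, expressing that the output differs from `u`. -/
def Circuit.tseitin {n : ℕ} (C : Circuit n) : Finset (Clause (EncVar n)) :=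
  C.gates.tseitin ∪ {{(wireVar C.output, true), (.u, true)},
    {(wireVar C.output, false), (.u, false)}}

/-- `v` is a variable of the encoding of a circuit with `s` gates. -/
def EncVar.InScope {n : ℕ} (s : ℕ) : EncVar n → Prop
  | .x _ => True
  | .u => True
  | .y j => j < s

theorem wireVar_inScope {n s : ℕ} (w : Fin n ⊕ Fin s) : (wireVar w).InScope s := by
  cases w with
  | inl i => trivial
  | inr j => exact j.isLt

theorem EncVar.InScope.succ {n s : ℕ} {v : EncVar n} (h : v.InScope s) : v.InScope (s + 1) := by
  cases v with
  | x i => trivial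
  | u => trivial
  | y j => exact Nat.lt_succ_of_lt h

theorem Gate.tseitin_inScope {n s : ℕ} (g : Gate (Fin n ⊕ Fin s)) :
    ∀ C ∈ g.tseitin (.y s), ∀ l ∈ C, l.1.InScope (s + 1) := by
  have hy : (EncVar.y s : EncVar n).InScope (s + 1) := Nat.lt_succ_self s
  have hw := fun w : Fin n ⊕ Fin s => (wireVar_inScope w).succ
  intro C hC l hl
  cases g <;> simp only [Gate.tseitin, Finset.mem_insert, Finset.mem_singleton] at hC <;> grind

theorem GateSeq.tseitin_inScope {n s : ℕ} (P : GateSeq n s) :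
    ∀ C ∈ P.tseitin, ∀ l ∈ C, l.1.InScope s := by
  induction P with
  | nil => simp [GateSeq.tseitin]
  | snoc P g ih =>
    intro C hC l hl
    rcases Finset.mem_union.1 hC with h | h
    · exact (ih C h l hl).succ
    · exact g.tseitin_inScope C h l hl

theorem Circuit.tseitin_inScope {n : ℕ} (C : Circuit n) :
    ∀ D ∈ C.tseitin, ∀ l ∈ D, l.1.InScope C.size := by
  intro D hD l hl
  rcases Finset.mem_union.1 hD with h | h
  · exact C.gates.tseitin_inScope D h l hl
  · have hu : (EncVar.u : EncVar n).InScope C.size := trivial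
    have hw := wireVar_inScope C.output
    simp only [Finset.mem_insert, Finset.mem_singleton] at h
    rcases h with rfl | rfl <;> simp only [Finset.mem_insert, Finset.mem_singleton] at hl <;>
      rcases hl with rfl | rfl <;> assumption

/-- The QBF `∃ X ∀ u ∃ Y. φ(X, u, Y)` obtained from a circuit. -/
def Circuit.toQBF {n : ℕ} (C : Circuit n) : QBF (EncVar n) where
  blocks := [(.ex, Finset.univ.image EncVar.x), (.all, {EncVar.u}),
    (.ex, (Finset.range C.size).image EncVar.y)]
  matrix := C.tseitin
  disjoint := by
    simp [Finset.disjoint_left]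
  alternating := by simp
  closed := by
    intro D hD l hl
    have h := C.tseitin_inScope D hD l hl
    generalize l.1 = v at h
    cases v with
    | x i => simp
    | u => simp
    | y j => simpa [EncVar.InScope] using h

/-- `Φ` is a QBF encoding of the Boolean function `f`: it is obtained by the Tseitin transformation
from a Boolean circuit that computes `f`. -/
def IsQBFEncoding {n : ℕ} (f : (Fin n → Bool) → Bool) (Φ : QBF (EncVar n)) : Prop :=
  ∃ C : Circuit n, (∀ α, C.eval α = f α) ∧ Φ = C.toQBF

/-! ### Walks in merge maps -/

namespace MergeMap

variable {V : Type} {S : Finset V}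

/-! The hard function tests whether a square matrix of side m = 2h, stored in the first m² of the n
input bits with h = ⌊⌊√n⌋/2⌋, is a permutation matrix. It has circuits of cubic size in m, so its
Tseitin encodings are small. The lower bound reads a branching program off the final merge map of
`u`.

Three facts turn a regular refutation into a small read-once program. The program computes the
encoded function (`MResRefutation.sound`, `Circuit.map_last_computes`): at the empty clause every
answer of the map must falsify the matrix, and once the gate variables carry their true values this
forces `u` to equal the output. It is read-once (`MResRefutation.IsRegular.nodup_walk`), because the
queries on a walk reappear, in reverse order, as pivots on one path of the derivation. It has no
more lines than the proof (`MResRefutation.card_dom_le`), because every line number of the map is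
the leading one of some proof line.

A read-once program for the permutation test needs at least m.choose h lines
(`MergeMap.choose_le_card_dom`). The walk of a permutation matrix must read all m ones; cut it after
h of them. If the walks of σ and π are cut at the same line, the first half of one followed by the
second half of the other is again an accepting walk, and this forces the same row set R and σ(R) =
π(R). Hence a line serves at most h!(m - h)! of the m! permutations. Finally, (2h).choose h ≥ 2^h.
-/

/-- `M.Walk i τ j`: following the instructions of `M` from line `i`, with the answers recorded in
`τ`, leads to line `j`. -/
inductive Walk (M : MergeMap S) : ℕ → List (V × Bool) → ℕ → Prop where
  | nil (i : ℕ) : Walk M i [] i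
  | cons {i : ℕ} {x : V} {a b : ℕ} {c : Bool} {τ : List (V × Bool)} {j : ℕ}
      (h : M.instr i = some (.query x a b)) (w : Walk M (if c then b else a) τ j) :
      Walk M i ((x, c) :: τ) j

theorem top_mem (M : MergeMap S) : M.top ∈ M.dom := M.dom.max'_mem _

theorem le_top (M : MergeMap S) {i : ℕ} (h : i ∈ M.dom) : i ≤ M.top := M.dom.le_max' i h

theorem Walk.target_mem {M : MergeMap S} {i j : ℕ} {τ : List (V × Bool)} (w : M.Walk i τ j) :
    i ∈ M.dom → j ∈ M.dom := by
  induction w with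
  | nil i => exact id
  | cons h w ih =>
    intro _
    have := M.query_mem _ _ _ _ h
    apply ih
    split <;> simp [this]

theorem Walk.le {M : MergeMap S} {i j : ℕ} {τ : List (V × Bool)} (w : M.Walk i τ j) : j ≤ i := by
  induction w with
  | nil i => exact le_rfl
  | cons h w ih =>
    have := M.query_mem _ _ _ _ h
    refine ih.trans ?_
    split <;> omega

theorem Walk.var_mem {M : MergeMap S} {i j : ℕ} {τ : List (V × Bool)} (w : M.Walk i τ j) :
    ∀ p ∈ τ, p.1 ∈ S := by
  induction w with
  | nil i => simp
  | cons h w ih =>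
    intro p hp
    rcases List.mem_cons.1 hp with rfl | hp
    · exact (M.query_mem _ _ _ _ h).1
    · exact ih p hp

theorem Walk.append {M : MergeMap S} {i j k : ℕ} {τ τ' : List (V × Bool)} (w : M.Walk i τ j)
    (w' : M.Walk j τ' k) : M.Walk i (τ ++ τ') k := by
  induction w with
  | nil i => exact w'
  | cons h w ih => exact .cons h (ih w')

theorem Walk.split {M : MergeMap S} {τ τ' : List (V × Bool)} :
    ∀ {i k : ℕ}, M.Walk i (τ ++ τ') k → ∃ j, M.Walk i τ j ∧ M.Walk j τ' k := by
  induction τ with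
  | nil => exact fun {i k} w => ⟨i, .nil i, w⟩
  | cons p τ ih =>
    intro i k w
    cases w with
    | cons h w =>
      obtain ⟨j, h1, h2⟩ := ih w
      exact ⟨j, .cons h h1, h2⟩

/-- Every assignment leads from every line to an output. -/
theorem exists_walk (M : MergeMap S) (α : V → Bool) (i : ℕ) :
    i ∈ M.dom → ∃ τ j o, M.Walk i τ j ∧ M.instr j = some (.out o) ∧ ∀ p ∈ τ, α p.1 = p.2 := by
  induction i using Nat.strong_induction_on with
  | _ i ih =>
    intro hi
    rcases hI : M.instr i with _ | ⟨o⟩ | ⟨x, a, b⟩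
    · exact absurd hI ((M.mem_dom i).1 hi)
    · exact ⟨[], i, o, .nil i, hI, by simp⟩
    · have hq := M.query_mem _ _ _ _ hI
      obtain ⟨τ, j, o, w, ho, hτ⟩ := ih (if α x then b else a) (by split <;> omega)
        (by split <;> simp [hq])
      refine ⟨(x, α x) :: τ, j, o, .cons hI w, ho, ?_⟩
      intro p hp
      rcases List.mem_cons.1 hp with rfl | hp
      · rfl
      · exact hτ p hp

theorem Walk.of_agree {M N : MergeMap S} (h : ∀ i ∈ M.dom, N.instr i = M.instr i) {i j : ℕ}
    {τ : List (V × Bool)} (w : M.Walk i τ j) : i ∈ M.dom → N.Walk i τ j := by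
  induction w with
  | nil i => exact fun _ => .nil i
  | cons hI w ih =>
    intro hi
    have := M.query_mem _ _ _ _ hI
    exact .cons ((h _ hi).trans hI) (ih (by split <;> simp [this]))

/-- Queries of `M` refer only to lines of `M`, so a walk in `N` that starts in the submap `M` cannot
leave it. -/
theorem Walk.to_agree {M N : MergeMap S} (h : ∀ i ∈ M.dom, N.instr i = M.instr i) {i j : ℕ}
    {τ : List (V × Bool)} (w : N.Walk i τ j) : i ∈ M.dom → M.Walk i τ j := by
  induction w with
  | nil i => exact fun _ => .nil i
  | cons hI w ih =>
    intro hi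
    rw [h _ hi] at hI
    have := M.query_mem _ _ _ _ hI
    exact .cons hI (ih (by split <;> simp [this]))

theorem Walk.map {M N : MergeMap S} {σ : ℕ → ℕ}
    (h : ∀ i ∈ M.dom, N.instr (σ i) = (M.instr i).map (Instr.relabel σ)) {i j : ℕ}
    {τ : List (V × Bool)} (w : M.Walk i τ j) : i ∈ M.dom → N.Walk (σ i) τ (σ j) := by
  induction w with
  | nil i => exact fun _ => .nil _
  | @cons i x a b c τ j hI w ih =>
    intro hi
    have hq := M.query_mem _ _ _ _ hI
    have hN : N.instr (σ i) = some (.query x (σ a) (σ b)) := by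
      rw [h _ hi, hI]; rfl
    have := ih (by split <;> simp [hq])
    exact .cons hN (by rw [apply_ite σ] at this; exact this)

/-- Every line of the merge map is reachable from the leading one. -/
def Accessible (M : MergeMap S) : Prop := ∀ i ∈ M.dom, ∃ τ, M.Walk M.top τ i

/-- An isomorphism need not respect the order of line numbers, so that it matches leading lines
needs accessibility: the preimage of `N.top` is reached by a walk from `M.top`, its image is a walk
from `σ M.top` to `N.top`, and walks never go up. -/
theorem Accessible.top_of_iso {M N : MergeMap S} (hM : M.Accessible) {σ : ℕ → ℕ}
    (hσ : Set.BijOn σ M.dom N.dom)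
    (h : ∀ i ∈ M.dom, N.instr (σ i) = (M.instr i).map (Instr.relabel σ)) : σ M.top = N.top := by
  apply le_antisymm (N.le_top (hσ.mapsTo M.top_mem))
  obtain ⟨i, hi, hiN⟩ := hσ.surjOn N.top_mem
  obtain ⟨τ, w⟩ := hM i hi
  rw [← hiN]
  exact (w.map h M.top_mem).le

@[simp] theorem simple_top (i : ℕ) (b : Option Bool) : (simple S i b).top = i :=
  Finset.mem_singleton.1 (simple S i b).top_mem

@[simp] theorem simple_instr (i : ℕ) (b : Option Bool) :
    (simple S i b).instr i = some (.out b) := by simp [simple]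

theorem Walk.eq_nil_of_out {M : MergeMap S} {i j : ℕ} {τ : List (V × Bool)} {o : Option Bool}
    (w : M.Walk i τ j) (h : M.instr i = some (.out o)) : τ = [] ∧ j = i := by
  cases w with
  | nil => simp
  | cons hI _ => simp [h] at hI

theorem simple_accessible (i : ℕ) (b : Option Bool) : (simple S i b).Accessible := by
  intro k hk
  have : k = i := Finset.mem_singleton.1 hk
  subst this
  exact ⟨[], by rw [simple_top]; exact .nil k⟩

namespace IsMerge

variable {x : V} {M₀ M₁ M : MergeMap S}

theorem instr_top (h : IsMerge x M₀ M₁ M) : M.instr M.top = some (.query x M₀.top M₁.top) := by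
  obtain ⟨-, l, hl, hd, hI, -, -⟩ := h
  have : M.top = l := by
    apply le_antisymm
    · have := M.top_mem
      rw [hd, Finset.mem_insert] at this
      exact this.elim Eq.le (fun h => (hl _ h).le)
    · exact M.le_top (by simp [hd])
  rw [this, hI]

theorem instr_left (h : IsMerge x M₀ M₁ M) : ∀ i ∈ M₀.dom, M.instr i = M₀.instr i := by
  obtain ⟨-, l, hl, hd, hI, h0, h1⟩ := h
  exact h0

theorem instr_right (h : IsMerge x M₀ M₁ M) : ∀ i ∈ M₁.dom, M.instr i = M₁.instr i := by
  obtain ⟨-, l, hl, hd, hI, h0, h1⟩ := h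
  exact h1

theorem mem_dom (h : IsMerge x M₀ M₁ M) {i : ℕ} (hi : i ∈ M.dom) :
    i = M.top ∨ i ∈ M₀.dom ∨ i ∈ M₁.dom := by
  have ht := M.top_mem
  obtain ⟨-, l, hl, hd, -, -, -⟩ := h
  have hlt : l ≤ M.top := M.le_top (by simp [hd])
  rw [hd, Finset.mem_insert, Finset.mem_union] at hi
  rcases hi with rfl | hi
  · left
    rw [hd, Finset.mem_insert] at ht
    exact ht.elim Eq.symm (fun h => absurd (hl _ h) (by omega))
  · exact .inr hi

theorem accessible (h : IsMerge x M₀ M₁ M) (h₀ : M₀.Accessible) (h₁ : M₁.Accessible) :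
    M.Accessible := by
  intro i hi
  rcases h.mem_dom hi with rfl | hi | hi
  · exact ⟨[], .nil _⟩
  · obtain ⟨τ, w⟩ := h₀ i hi
    exact ⟨(x, false) :: τ, .cons h.instr_top (by simpa using w.of_agree h.instr_left M₀.top_mem)⟩
  · obtain ⟨τ, w⟩ := h₁ i hi
    exact ⟨(x, true) :: τ, .cons h.instr_top (by simpa using w.of_agree h.instr_right M₁.top_mem)⟩

/-- A walk from the leading line of a merge is empty, or enters one of the two merged maps. -/
theorem walk_cases (h : IsMerge x M₀ M₁ M) {τ : List (V × Bool)} {j : ℕ}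
    (w : M.Walk M.top τ j) : (τ = [] ∧ j = M.top) ∨
      (∃ τ', τ = (x, false) :: τ' ∧ M₀.Walk M₀.top τ' j ∧ j ∈ M₀.dom) ∨
      (∃ τ', τ = (x, true) :: τ' ∧ M₁.Walk M₁.top τ' j ∧ j ∈ M₁.dom) := by
  cases w with
  | nil => exact .inl ⟨rfl, rfl⟩
  | @cons _ y a b c τ' _ hI w =>
    right
    rw [h.instr_top] at hI
    cases hI
    cases c with
    | false =>
      have w' := Walk.to_agree h.instr_left (by simpa using w) M₀.top_mem
      exact .inl ⟨τ', rfl, w', w'.target_mem M₀.top_mem⟩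
    | true =>
      have w' := Walk.to_agree h.instr_right (by simpa using w) M₁.top_mem
      exact .inr ⟨τ', rfl, w', w'.target_mem M₁.top_mem⟩

end IsMerge

end MergeMap

/-! ### Properties of Merge Resolution derivations -/

section Derivations

variable {V : Type} [DecidableEq V] {Φ : QBF V}

/-- The assignment `α` falsifies the clause `C`. -/
def Clause.Falsified (α : V → Bool) (C : Clause V) : Prop := ∀ l ∈ C, α l.1 ≠ l.2

/-- For all assignments falsifying the clause of the line, any value of `u` that is compatible with
the merge map falsifies a clause of the matrix. -/
def MLine.Sound (L : MLine Φ) (u : Φ.univVars) : Prop :=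
  ∀ (α : V → Bool) (b : Bool) (τ : List (V × Bool)) (j : ℕ) (o : Option Bool),
    L.clause.Falsified α → (L.map u).Walk (L.map u).top τ j → (L.map u).instr j = some (.out o) →
    (∀ p ∈ τ, α p.1 = p.2) → (o = none ∨ o = some b) →
    ∃ A ∈ Φ.matrix, Clause.Falsified (Function.update α (u : V) b) A

theorem IsInitialLine.map_eq_simple {A : Clause V} {L : MLine Φ} (h : IsInitialLine Φ A L)
    (u : Φ.univVars) :
    ∃ i b, IsFalsifyingValue A (u : V) b ∧ L.map u = MergeMap.simple (Φ.left u) i b := by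
  obtain ⟨-, -, i, hi⟩ := h
  obtain ⟨b, hb⟩ := hi u
  exact ⟨i, b, hb⟩

theorem IsInitialLine.sound {A : Clause V} {L : MLine Φ} (h : IsInitialLine Φ A L)
    (u : Φ.univVars) (hu : (u : V) ∉ Φ.existVars)
    (hA : ∀ l ∈ A, l.1 ∈ Φ.existVars ∨ l.1 = (u : V)) : L.Sound u := by
  intro α b τ j o hα w ho _ hob
  obtain ⟨i, c, hc, hL⟩ := h.map_eq_simple u
  rw [hL, MergeMap.simple_top] at w
  obtain ⟨-, rfl⟩ := w.eq_nil_of_out (MergeMap.simple_instr i c)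
  rw [hL, MergeMap.simple_instr] at ho
  cases ho
  refine ⟨A, h.1, ?_⟩
  rintro ⟨v, d⟩ hl
  rcases hA _ hl with hv | rfl
  · have hne : v ≠ u := fun hvu => hu (hvu ▸ hv)
    simp only [ne_eq, Function.update_of_ne hne]
    exact hα _ (by rw [h.2.1]; exact Finset.mem_filter.2 ⟨hl, hv⟩)
  · rcases hob with rfl | rfl
    · cases d
      · exact absurd hl hc.2
      · exact absurd hl hc.1
    · simp only [Function.update_self]
      rintro rfl
      exact hc.2 hl

theorem IsResolvent.falsified_left {x : V} {L₀ L₁ L : MLine Φ} (h : IsResolvent Φ x L₀ L₁ L)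
    {α : V → Bool} (hα : L.clause.Falsified α) (hx : α x = false) : L₀.clause.Falsified α := by
  intro l hl
  by_cases hlx : l = (x, true)
  · simp [hlx, hx]
  · exact hα l (by rw [h.2.2.2.1]; simp [hl, hlx])

theorem IsResolvent.falsified_right {x : V} {L₀ L₁ L : MLine Φ} (h : IsResolvent Φ x L₀ L₁ L)
    {α : V → Bool} (hα : L.clause.Falsified α) (hx : α x = true) : L₁.clause.Falsified α := by
  intro l hl
  by_cases hlx : l = (x, false)
  · simp [hlx, hx]
  · exact hα l (by rw [h.2.2.2.1]; simp [hl, hlx])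

/-- The value `*` is compatible with both values of `u`, so a parent with a trivial map is sound for
every answer. This is why the resolution rule may keep the other parent's map. -/
theorem MLine.Sound.of_isTrivial {L : MLine Φ} {u : Φ.univVars} (h : L.Sound u)
    (ht : (L.map u).IsTrivial) {α : V → Bool} (hα : L.clause.Falsified α) (b : Bool) :
    ∃ A ∈ Φ.matrix, Clause.Falsified (Function.update α (u : V) b) A := by
  obtain ⟨i, hi⟩ := ht
  exact h α b [] _ none hα (.nil _) (by rw [hi]; simp) (by simp) (.inl rfl)

theorem IsResolvent.accessible {x : V} {L₀ L₁ L : MLine Φ} (h : IsResolvent Φ x L₀ L₁ L)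
    (u : Φ.univVars) (h₀ : (L₀.map u).Accessible) (h₁ : (L₁.map u).Accessible) :
    (L.map u).Accessible := by
  rcases h.2.2.2.2 u with ⟨-, e⟩ | ⟨-, e⟩ | ⟨-, e⟩ | ⟨-, hm⟩
  · rwa [e]
  · rwa [e]
  · rwa [e]
  · exact hm.accessible h₀ h₁

/-- An assignment falsifying the resolvent falsifies the parent selected by the value of the pivot.
In each case of the rule, either the walk can be followed in that parent's map, or that map is
trivial. -/
theorem IsResolvent.sound {x : V} {L₀ L₁ L : MLine Φ} (h : IsResolvent Φ x L₀ L₁ L)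
    (u : Φ.univVars) (hacc : (L₀.map u).Accessible) (h₀ : L₀.Sound u) (h₁ : L₁.Sound u) :
    L.Sound u := by
  intro α b τ j o hα w ho hτ hob
  rcases h.2.2.2.2 u with ⟨ht, e⟩ | ⟨ht, e⟩ | ⟨hi, e⟩ | ⟨-, hm⟩
  · rw [e] at w ho
    cases hx : α x
    · exact h₀.of_isTrivial ht (h.falsified_left hα hx) b
    · exact h₁ α b τ j o (h.falsified_right hα hx) w ho hτ hob
  · rw [e] at w ho
    cases hx : α x
    · exact h₀ α b τ j o (h.falsified_left hα hx) w ho hτ hob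
    · exact h₁.of_isTrivial ht (h.falsified_right hα hx) b
  · rw [e] at w ho
    cases hx : α x
    · exact h₀ α b τ j o (h.falsified_left hα hx) w ho hτ hob
    -- The kept map is that of `L₀`, but the falsified parent is `L₁`: the walk is carried over
    -- along the isomorphism.
    · obtain ⟨σ, hσ, hI⟩ := hi
      have w' := w.map hI (MergeMap.top_mem _)
      rw [hacc.top_of_iso hσ hI] at w'
      refine h₁ α b τ (σ j) o (h.falsified_right hα hx) w' ?_ hτ hob
      rw [hI j (w.target_mem (MergeMap.top_mem _)), ho]
      rfl
  · rcases hm.walk_cases w with ⟨-, rfl⟩ | ⟨τ', rfl, w', hj⟩ | ⟨τ', rfl, w', hj⟩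
    · simp [hm.instr_top] at ho
    · refine h₀ α b τ' j o (h.falsified_left hα (hτ (x, false) (by simp))) w' ?_
        (fun p hp => hτ p (by simp [hp])) hob
      rw [← hm.instr_left j hj, ho]
    · refine h₁ α b τ' j o (h.falsified_right hα (hτ (x, true) (by simp))) w' ?_
        (fun p hp => hτ p (by simp [hp])) hob
      rw [← hm.instr_right j hj, ho]

/-! ### Invariants along a whole refutation -/

namespace MResRefutation

/-- Induction along the lines of a refutation. -/
theorem line_induction (R : MResRefutation Φ) {P : Fin (R.last + 1) → Prop}
    (initial : ∀ i A, R.just i = .initial A → IsInitialLine Φ A (R.line i) → P i)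
    (res : ∀ i x a b, R.just i = .res x a b → IsResolvent Φ x (R.line a) (R.line b) (R.line i) →
      P a → P b → P i) (i : Fin (R.last + 1)) : P i := by
  induction i using WellFoundedLT.induction with
  | _ i ih =>
    have hv := R.valid i
    cases hj : R.just i with
    | initial A =>
      rw [hj] at hv
      exact initial i A hj hv
    | res x a b =>
      rw [hj] at hv
      exact res i x a b hj hv.2.2 (ih a hv.1) (ih b hv.2.1)

theorem accessible (R : MResRefutation Φ) (u : Φ.univVars) (i : Fin (R.last + 1)) :
    ((R.line i).map u).Accessible := by
  refine R.line_induction (P := fun i => ((R.line i).map u).Accessible) ?_ ?_ i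
  · intro i A _ h
    obtain ⟨k, b, -, e⟩ := h.map_eq_simple u
    rw [e]
    exact MergeMap.simple_accessible k b
  · intro i x a b _ h ha hb
    exact h.accessible u ha hb

theorem sound (R : MResRefutation Φ) (u : Φ.univVars) (hu : (u : V) ∉ Φ.existVars)
    (hA : ∀ A ∈ Φ.matrix, ∀ l ∈ A, l.1 ∈ Φ.existVars ∨ l.1 = (u : V)) (i : Fin (R.last + 1)) :
    (R.line i).Sound u := by
  refine R.line_induction (P := fun i => (R.line i).Sound u) ?_ ?_ i
  · intro i A _ h
    exact h.sound u hu (hA A h.1)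
  · intro i x a b _ h ha hb
    exact h.sound u (R.accessible u a) ha hb

/-- A line number enters a merge map only as the single instruction of a downloaded clause or as the
new leading instruction of a merge; in both cases it is the top of the map created there. -/
theorem dom_subset (R : MResRefutation Φ) (u : Φ.univVars) (i : Fin (R.last + 1)) :
    ((R.line i).map u).dom ⊆ Finset.univ.image (fun j => ((R.line j).map u).top) := by
  refine R.line_induction (P := fun i => ((R.line i).map u).dom ⊆
    Finset.univ.image (fun j => ((R.line j).map u).top)) ?_ ?_ i
  · intro i A _ h k hk
    refine Finset.mem_image.2 ⟨i, Finset.mem_univ _, ?_⟩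
    obtain ⟨l, b, -, e⟩ := h.map_eq_simple u
    rw [e] at hk ⊢
    rw [MergeMap.simple_top]
    exact (Finset.mem_singleton.1 hk).symm
  · intro i x a b _ h ha hb
    rcases h.2.2.2.2 u with ⟨-, e⟩ | ⟨-, e⟩ | ⟨-, e⟩ | ⟨-, hm⟩
    · rwa [e]
    · rwa [e]
    · rwa [e]
    · intro k hk
      rcases hm.mem_dom hk with rfl | hk | hk
      · exact Finset.mem_image_of_mem _ (Finset.mem_univ i)
      · exact ha hk
      · exact hb hk

theorem card_dom_le (R : MResRefutation Φ) (u : Φ.univVars) (i : Fin (R.last + 1)) :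
    ((R.line i).map u).dom.card ≤ R.size := by
  refine (Finset.card_le_card (R.dom_subset u i)).trans (Finset.card_image_le.trans ?_)
  simp [size]

/-- The queries along a walk in the merge map of a line occur as pivots on a path from a leaf. -/
theorem exists_path (R : MResRefutation Φ) (u : Φ.univVars) (i : Fin (R.last + 1)) :
    ∀ τ j, ((R.line i).map u).Walk ((R.line i).map u).top τ j →
      ∃ p : List (Fin (R.last + 1)), p.IsChain (fun a c => (R.just c).HasAntecedent a) ∧
        (∃ i A, p.head? = some i ∧ R.just i = .initial A) ∧ p.getLast? = some i ∧
        (τ.map (fun q => some q.1)).reverse.Sublist (p.map (fun i => (R.just i).pivot)) := by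
  have snoc : ∀ (i a : Fin (R.last + 1)) (p : List (Fin (R.last + 1))),
      (R.just i).HasAntecedent a → p.IsChain (fun a c => (R.just c).HasAntecedent a) →
      (∃ i A, p.head? = some i ∧ R.just i = .initial A) → p.getLast? = some a →
      (p ++ [i]).IsChain (fun a c => (R.just c).HasAntecedent a) ∧
      (∃ k A, (p ++ [i]).head? = some k ∧ R.just k = .initial A) ∧
      (p ++ [i]).getLast? = some i := by
    intro i a p hia hc ⟨k, A, hk, hkA⟩ hl
    refine ⟨?_, ⟨k, A, ?_, hkA⟩, by simp⟩
    · rw [List.isChain_append]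
      refine ⟨hc, by simp, ?_⟩
      intro y hy z hz
      simp only [List.head?_cons, Option.mem_def, Option.some.injEq] at hz
      rw [hl] at hy
      cases hy
      subst hz
      exact hia
    · simp [List.head?_append, hk]
  refine R.line_induction (P := fun i => ∀ τ j,
    ((R.line i).map u).Walk ((R.line i).map u).top τ j →
      ∃ p : List (Fin (R.last + 1)), p.IsChain (fun a c => (R.just c).HasAntecedent a) ∧
        (∃ i A, p.head? = some i ∧ R.just i = .initial A) ∧ p.getLast? = some i ∧
        (τ.map (fun q => some q.1)).reverse.Sublist (p.map (fun i => (R.just i).pivot))) ?_ ?_ i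
  · intro i A hi h τ j w
    obtain ⟨l, b, -, e⟩ := h.map_eq_simple u
    rw [e, MergeMap.simple_top] at w
    obtain ⟨rfl, -⟩ := w.eq_nil_of_out (MergeMap.simple_instr l b)
    exact ⟨[i], by simp, ⟨i, A, rfl, hi⟩, rfl, by simp⟩
  · intro i x a b hi h ha hb τ j w
    have hia : (R.just i).HasAntecedent a := by rw [hi]; exact .inl rfl
    have hib : (R.just i).HasAntecedent b := by rw [hi]; exact .inr rfl
    -- Given a path for the antecedent `c`, appending `i` gives a path for `i`. The walk `ρ` in the
    -- new map is the old one or has the pivot query put in front; reversing it puts that query at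
    -- the end, where `i` was appended.
    have keep : ∀ c, (R.just i).HasAntecedent c → (∀ τ j,
        ((R.line c).map u).Walk ((R.line c).map u).top τ j →
        ∃ p : List (Fin (R.last + 1)), p.IsChain (fun a c => (R.just c).HasAntecedent a) ∧
        (∃ i A, p.head? = some i ∧ R.just i = .initial A) ∧ p.getLast? = some c ∧
        (τ.map (fun q => some q.1)).reverse.Sublist (p.map (fun i => (R.just i).pivot))) →
        ∀ τ j, ((R.line c).map u).Walk ((R.line c).map u).top τ j → ∀ ρ : List (V × Bool),
        (ρ = τ ∨ ∃ d, ρ = (x, d) :: τ) →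
        ∃ p : List (Fin (R.last + 1)), p.IsChain (fun a c => (R.just c).HasAntecedent a) ∧
        (∃ i A, p.head? = some i ∧ R.just i = .initial A) ∧ p.getLast? = some i ∧
        (ρ.map (fun q => some q.1)).reverse.Sublist (p.map (fun i => (R.just i).pivot)) := by
      intro c hic hc τ j w ρ hρ
      obtain ⟨p, h1, h2, h3, h4⟩ := hc τ j w
      obtain ⟨g1, g2, g3⟩ := snoc i c p hic h1 h2 h3
      refine ⟨p ++ [i], g1, g2, g3, ?_⟩
      rw [List.map_append]
      rcases hρ with rfl | ⟨d, rfl⟩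
      · exact h4.trans (List.sublist_append_left _ _)
      · rw [List.map_cons, List.reverse_cons]
        refine h4.append ?_
        simp [hi, Justification.pivot]
    rcases h.2.2.2.2 u with ⟨-, e⟩ | ⟨-, e⟩ | ⟨-, e⟩ | ⟨-, hm⟩
    · rw [e] at w
      exact keep b hib hb τ j w τ (.inl rfl)
    · rw [e] at w
      exact keep a hia ha τ j w τ (.inl rfl)
    · rw [e] at w
      exact keep a hia ha τ j w τ (.inl rfl)
    · rcases hm.walk_cases w with ⟨rfl, -⟩ | ⟨τ', rfl, w', -⟩ | ⟨τ', rfl, w', -⟩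
      · exact keep a hia ha [] _ (.nil _) [] (.inl rfl)
      · exact keep a hia ha τ' j w' _ (.inr ⟨_, rfl⟩)
      · exact keep b hib hb τ' j w' _ (.inr ⟨_, rfl⟩)

/-- The merge maps at the end of a regular refutation are read-once. -/
theorem IsRegular.nodup_walk {R : MResRefutation Φ} (hR : R.IsRegular) (u : Φ.univVars)
    {τ : List (V × Bool)} {j : ℕ}
    (w : ((R.line (Fin.last _)).map u).Walk ((R.line (Fin.last _)).map u).top τ j) :
    (τ.map Prod.fst).Nodup := by
  obtain ⟨p, h1, h2, h3, h4⟩ := R.exists_path u _ τ j w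
  rw [List.nodup_iff_count_le_one]
  intro x
  by_cases hx : x ∈ τ.map Prod.fst
  · obtain ⟨q, hq, rfl⟩ := List.mem_map.1 hx
    have hS := w.var_mem q hq
    have hE : q.1 ∈ Φ.existVars := by
      simp only [QBF.left, Finset.mem_filter] at hS
      exact hS.1
    have h5 := h4.count_le (some q.1)
    have h6 : τ.map (fun q => some q.1) = (τ.map Prod.fst).map some := by simp
    rw [List.count_reverse, h6, List.count_map_of_injective _ _ (Option.some_injective _)] at h5
    exact h5.trans (hR q.1 hE p ⟨h1, h2, h3⟩)
  · rw [List.count_eq_zero_of_not_mem hx]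
    exact zero_le_one

end MResRefutation

end Derivations

/-! ### Read-once merge maps for the permutation matrix test -/

/-- The test whether a square matrix is a permutation matrix: every row contains a one, and no
column contains two of them. -/
def permTest {m : ℕ} (A : Fin m → Fin m → Bool) : Bool :=
  decide ((∀ i, ∃ j, A i j = true) ∧ ∀ i i' j, i ≠ i' → ¬(A i j = true ∧ A i' j = true))

theorem permTest_eq_true {m : ℕ} {A : Fin m → Fin m → Bool} : permTest A = true ↔
    (∀ i, ∃ j, A i j = true) ∧ ∀ i i' j, i ≠ i' → ¬(A i j = true ∧ A i' j = true) := by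
  simp only [permTest, decide_eq_true_eq]

/-- Such a permutation is determined by its two restrictions, one from `R` to `C` and one between
the complements. -/
theorem card_perm_iff_le {m h : ℕ} (R C : Finset (Fin m)) (hR : R.card = h) (hC : C.card = h) :
    (Finset.univ.filter (fun σ : Equiv.Perm (Fin m) => ∀ i, i ∈ R ↔ σ i ∈ C)).card ≤
      h.factorial * (m - h).factorial := by
  have e1 : {i // i ∈ R} ≃ {j // j ∈ C} := Fintype.equivOfCardEq (by simp [hR, hC])
  have e2 : {i // i ∉ R} ≃ {j // j ∉ C} := Fintype.equivOfCardEq (by simp [hR, hC])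
  have hcard : Fintype.card (({i // i ∈ R} ≃ {j // j ∈ C}) × ({i // i ∉ R} ≃ {j // j ∉ C})) =
      h.factorial * (m - h).factorial := by
    rw [Fintype.card_prod, Fintype.card_equiv e1, Fintype.card_equiv e2]
    simp [hR]
  rw [← hcard, ← Fintype.card_subtype]
  refine Fintype.card_le_of_injective
    (fun σ => (σ.1.subtypeEquiv σ.2, σ.1.subtypeEquiv fun i => not_congr (σ.2 i))) ?_
  rintro ⟨σ, hσ⟩ ⟨π, hπ⟩ heq
  simp only [Prod.mk.injEq] at heq
  apply Subtype.ext
  ext i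
  by_cases hi : i ∈ R
  · have := congrArg (fun f => ((f ⟨i, hi⟩ : {j // j ∈ C}) : Fin m)) heq.1
    simpa using congrArg Fin.val this
  · have := congrArg (fun f => ((f ⟨i, hi⟩ : {j // j ∉ C}) : Fin m)) heq.2
    simpa using congrArg Fin.val this

/-- A discrete intermediate value argument: lengthening a prefix by one entry raises the count by at
most one. -/
theorem List.exists_append_countP_eq {α : Type*} (p : α → Bool) (l : List α) :
    ∀ h ≤ l.countP p, ∃ l₁ l₂, l = l₁ ++ l₂ ∧ l₁.countP p = h := by
  induction l with
  | nil =>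
    intro h hh
    exact ⟨[], [], rfl, by simpa using Eq.symm (Nat.le_zero.1 hh)⟩
  | cons a l ih =>
    intro h hh
    rcases Nat.eq_zero_or_pos h with rfl | hpos
    · exact ⟨[], a :: l, rfl, rfl⟩
    · rw [List.countP_cons] at hh
      obtain ⟨l₁, l₂, hl, h1⟩ := ih (h - if p a then 1 else 0) (by split at hh <;> simp_all)
      refine ⟨a :: l₁, l₂, by simp [hl], ?_⟩
      rw [List.countP_cons, h1]
      split <;> omega

/-! ### Cutting and exchanging accepting walks -/

namespace MergeMap

variable {V : Type} [DecidableEq V] {S : Finset V}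

/-- A walk accepting the matrix of `σ`, cut at the line `v` where `h` ones have been read, namely
those in the rows in `R`. -/
structure AcceptingCut (M : MergeMap S) {m : ℕ} (e : Fin m → Fin m → V) (h : ℕ)
    (σ : Equiv.Perm (Fin m)) where
  v : ℕ
  R : Finset (Fin m)
  τ₁ : List (V × Bool)
  τ₂ : List (V × Bool)
  target : ℕ
  card_R : R.card = h
  walk₁ : M.Walk M.top τ₁ v
  walk₂ : M.Walk v τ₂ target
  accept : M.instr target = some (.out (some true))
  all_mem : ∀ i, (e i (σ i), true) ∈ τ₁ ++ τ₂
  eq_of_mem : ∀ i j, (e i j, true) ∈ τ₁ ++ τ₂ → j = σ i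
  mem_R : ∀ i, i ∈ R ↔ (e i (σ i), true) ∈ τ₁

variable {M : MergeMap S} {m h : ℕ} {e : Fin m → Fin m → V}

/-- The walk on the matrix of `σ` answers true exactly `m` times, once per row, so some prefix
contains exactly `h` of these answers. -/
theorem exists_acceptingCut (hm : h ≤ m)
    (he : ∀ i j i' j', e i j = e i' j' → i = i' ∧ j = j')
    (hM : ∀ τ j, M.Walk M.top τ j → (τ.map Prod.fst).Nodup)
    (hF : ∀ (γ : V → Bool) τ j o, M.Walk M.top τ j → M.instr j = some (.out o) →
      (∀ p ∈ τ, γ p.1 = p.2) → o = some (permTest fun i j => γ (e i j)))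
    (σ : Equiv.Perm (Fin m)) : Nonempty (M.AcceptingCut e h σ) := by
  let α : V → Bool := fun y => decide (∃ i, y = e i (σ i))
  have hα : ∀ i j, α (e i j) = true ↔ j = σ i := by
    intro i j
    simp only [α, decide_eq_true_eq]
    constructor
    · rintro ⟨i', hi'⟩
      obtain ⟨rfl, rfl⟩ := he _ _ _ _ hi'
      rfl
    · rintro rfl
      exact ⟨i, rfl⟩
  obtain ⟨τ, t, o, w, ho, hτ⟩ := M.exists_walk α M.top M.top_mem
  have hacc : permTest (fun i j => α (e i j)) = true := by
    rw [permTest_eq_true]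
    refine ⟨fun i => ⟨σ i, (hα _ _).2 rfl⟩, ?_⟩
    rintro i i' j hne ⟨h1, h2⟩
    rw [hα] at h1 h2
    exact hne (σ.injective (h1.symm.trans h2))
  have hot := hF α τ t o w ho hτ
  rw [hacc] at hot
  subst hot
  have hall : ∀ i, (e i (σ i), true) ∈ τ := by
    intro i
    by_contra hi
    -- Were the one in row `i` not read, erasing it would leave the walk unchanged and accepting,
    -- although row `i` is now empty.
    have hτ' : ∀ p ∈ τ, Function.update α (e i (σ i)) false p.1 = p.2 := by
      rintro ⟨y, c⟩ hp
      have hc := hτ _ hp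
      by_cases hy : y = e i (σ i)
      · subst hy
        rw [(hα _ _).2 rfl] at hc
        exact absurd (hc ▸ hp) hi
      · simpa [Function.update_of_ne hy] using hc
    have h1 := hF _ τ t _ w ho hτ'
    have h2 := (permTest_eq_true.1 (Option.some.inj h1).symm).1 i
    obtain ⟨j, hj⟩ := h2
    by_cases hy : e i j = e i (σ i)
    · simp [hy] at hj
    · rw [Function.update_of_ne hy, hα] at hj
      exact hy (by rw [hj])
  -- Since the walk is read-once, no entry is counted twice: true answers correspond to rows.
  have hrow : ∀ τ' : List (V × Bool), τ'.Sublist τ →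
      (Finset.univ.filter fun i => (e i (σ i), true) ∈ τ').card = τ'.countP (fun p => p.2) := by
    intro τ' hsub
    have hnd : (τ'.filter (fun p => p.2)).Nodup :=
      (List.Nodup.of_map _ ((hM _ _ w).sublist (hsub.map _))).filter _
    rw [List.countP_eq_length_filter, ← List.toFinset_card_of_nodup hnd]
    refine Finset.card_bij (fun i _ => (e i (σ i), true)) ?_ ?_ ?_
    · intro i hi
      simpa using hi
    · intro i _ i' _ hii
      exact (he _ _ _ _ (Prod.mk.inj hii).1).1
    · rintro ⟨y, c⟩ hp
      simp only [List.mem_toFinset, List.mem_filter] at hp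
      obtain ⟨hp, rfl⟩ := hp
      have hy := hτ _ (hsub.subset hp)
      simp only [α, decide_eq_true_eq] at hy
      obtain ⟨i, rfl⟩ := hy
      exact ⟨i, by simpa using hp, rfl⟩
  have hcount : τ.countP (fun p => p.2) = m := by
    rw [← hrow τ (List.Sublist.refl _), Finset.filter_true_of_mem (fun i _ => hall i)]
    simp
  obtain ⟨τ₁, τ₂, rfl, h1⟩ := τ.exists_append_countP_eq (fun p => p.2) h (by omega)
  obtain ⟨v, w1, w2⟩ := w.split
  exact ⟨{
    v := v
    R := Finset.univ.filter fun i => (e i (σ i), true) ∈ τ₁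
    τ₁ := τ₁
    τ₂ := τ₂
    target := t
    card_R := (hrow τ₁ (List.sublist_append_left _ _)).trans h1
    walk₁ := w1
    walk₂ := w2
    accept := ho
    all_mem := hall
    eq_of_mem := fun i j hij => (hα i j).1 (hτ _ hij)
    mem_R := fun i => by simp }⟩

namespace AcceptingCut

/-- Exchanging the second halves of two walks through the same line gives an accepted matrix. -/
theorem exchange
    (hM : ∀ τ j, M.Walk M.top τ j → (τ.map Prod.fst).Nodup)
    (hF : ∀ (γ : V → Bool) τ j o, M.Walk M.top τ j → M.instr j = some (.out o) →
      (∀ p ∈ τ, γ p.1 = p.2) → o = some (permTest fun i j => γ (e i j)))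
    {σ π : Equiv.Perm (Fin m)} (a : M.AcceptingCut e h σ) (b : M.AcceptingCut e h π)
    (hv : a.v = b.v) : b.R = a.R ∧ ∀ i ∈ a.R, ∀ k ∉ a.R, σ i ≠ π k := by
  -- Every one of `π` is read on exactly one side of the cut.
  have hdisj : ∀ i, (e i (π i), true) ∈ b.τ₂ ↔ i ∉ b.R := by
    intro i
    have hnd := hM _ _ (b.walk₁.append b.walk₂)
    rw [List.map_append, List.nodup_append] at hnd
    have hi := b.all_mem i
    rw [List.mem_append] at hi
    rw [b.mem_R]
    constructor
    · intro h2 h1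
      exact hnd.2.2 _ (List.mem_map_of_mem h1) _ (List.mem_map_of_mem h2) rfl
    · exact hi.resolve_left
  have w := a.walk₁.append (hv ▸ b.walk₂)
  have hnd := hM _ _ w
  -- The matrix whose ones are exactly the true answers on the spliced walk; entries that are not
  -- read become zero. Read-onceness of the spliced walk makes `γ` agree with its false answers as
  -- well.
  let γ : V → Bool := fun y => decide ((y, true) ∈ a.τ₁ ++ b.τ₂)
  have hγ : ∀ p ∈ a.τ₁ ++ b.τ₂, γ p.1 = p.2 := by
    rintro ⟨y, c⟩ hp
    cases c
    · simp only [γ, decide_eq_false_iff_not]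
      intro hp'
      simpa using List.inj_on_of_nodup_map hnd hp hp' rfl
    · simpa [γ] using hp
  have hacc := permTest_eq_true.1 (Option.some.inj (hF γ _ _ _ w b.accept hγ)).symm
  simp only [γ, decide_eq_true_eq] at hacc
  obtain ⟨hrow, hcol⟩ := hacc
  -- If `i ∈ b.R`, then `π`'s one in row `i` lies in the discarded half `b.τ₁`. So the one that row
  -- `i` of the accepted matrix must contain comes from `a.τ₁`.
  have hsub : b.R ⊆ a.R := by
    intro i hi
    obtain ⟨j, hj⟩ := hrow i
    rcases List.mem_append.1 hj with hj | hj
    · have := a.eq_of_mem i j (List.mem_append_left _ hj)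
      rw [a.mem_R, ← this]
      exact hj
    · have := b.eq_of_mem i j (List.mem_append_right _ hj)
      rw [this, hdisj] at hj
      exact absurd hi hj
  have hR : b.R = a.R := Finset.eq_of_subset_of_card_le hsub (by rw [a.card_R, b.card_R])
  refine ⟨hR, ?_⟩
  intro i hi k hk heq
  refine hcol i k (σ i) (fun hik => hk (hik ▸ hi)) ⟨?_, ?_⟩
  · exact List.mem_append_left _ ((a.mem_R i).1 hi)
  · rw [heq]
    exact List.mem_append_right _ ((hdisj k).2 (hR ▸ hk))

end AcceptingCut

/-- A read-once merge map for the permutation matrix test has at least `m.choose h` lines. -/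
theorem choose_le_card_dom (hm : h ≤ m)
    (he : ∀ i j i' j', e i j = e i' j' → i = i' ∧ j = j')
    (hM : ∀ τ j, M.Walk M.top τ j → (τ.map Prod.fst).Nodup)
    (hF : ∀ (γ : V → Bool) τ j o, M.Walk M.top τ j → M.instr j = some (.out o) →
      (∀ p ∈ τ, γ p.1 = p.2) → o = some (permTest fun i j => γ (e i j))) :
    m.choose h ≤ M.dom.card := by
  have c : ∀ σ, M.AcceptingCut e h σ := fun σ => (exists_acceptingCut hm he hM hF σ).some
  have hbound : ∀ v ∈ Finset.univ.image (fun σ => (c σ).v),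
      (Finset.univ.filter fun σ => (c σ).v = v).card ≤ h.factorial * (m - h).factorial := by
    intro v hv
    obtain ⟨π, -, rfl⟩ := Finset.mem_image.1 hv
    have hC : ((c π).R.image π).card = h := by
      rw [Finset.card_image_of_injective _ π.injective, (c π).card_R]
    refine le_trans (Finset.card_le_card ?_) (card_perm_iff_le (c π).R ((c π).R.image π)
      (c π).card_R hC)
    intro σ hσ
    simp only [Finset.mem_filter, Finset.mem_univ, true_and] at hσ ⊢
    -- Splicing in both orders shows that σ(R) misses π(Rᶜ) and π(R) misses σ(Rᶜ), hence σ(R) =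
    -- π(R).
    obtain ⟨hR, h1⟩ := (c σ).exchange hM hF (c π) hσ
    obtain ⟨-, h2⟩ := (c π).exchange hM hF (c σ) hσ.symm
    intro i
    constructor
    · intro hi
      refine Finset.mem_image.2 ⟨π.symm (σ i), ?_, by simp⟩
      by_contra hk
      rw [hR] at hi hk
      exact h1 i hi _ hk (by simp)
    · intro hi
      obtain ⟨k, hk, hki⟩ := Finset.mem_image.1 hi
      by_contra hi'
      exact h2 k hk i hi' hki
  have hle := Finset.card_le_mul_card_image (Finset.univ : Finset (Equiv.Perm (Fin m))) _ hbound
  have hdom : (Finset.univ.image (fun σ => (c σ).v)).card ≤ M.dom.card := by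
    apply Finset.card_le_card
    intro v hv
    obtain ⟨σ, -, rfl⟩ := Finset.mem_image.1 hv
    exact (c σ).walk₁.target_mem M.top_mem
  have htotal := hle.trans (Nat.mul_le_mul_left _ hdom)
  rw [Finset.card_univ, Fintype.card_perm, Fintype.card_fin,
    ← Nat.choose_mul_factorial_mul_factorial hm, mul_assoc, mul_comm] at htotal
  exact Nat.le_of_mul_le_mul_left htotal (by positivity)

end MergeMap

/-! ### Circuits -/

/-- Replaces the inputs of a gate. -/
def Gate.map {W W' : Type} (r : W → W') : Gate W → Gate W'
  | .const b => .const b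
  | .not a => .not (r a)
  | .and a b => .and (r a) (r b)
  | .or a b => .or (r a) (r b)

theorem Gate.eval_map {W W' : Type} (r : W → W') (v : W' → Bool) (g : Gate W) :
    (g.map r).eval v = g.eval (v ∘ r) := by
  cases g <;> rfl

namespace GateSeq

variable {n s : ℕ}

/-- The gates of `P`, followed by those of a sequence that does not refer to `P`. -/
def append (P : GateSeq n s) : {t : ℕ} → GateSeq n t → GateSeq n (s + t)
  | _, .nil => P
  | _, .snoc Q g => .snoc (P.append Q) (g.map (Sum.map id (Fin.natAdd s)))

theorem val_snoc_last (P : GateSeq n s) (g : Gate (Fin n ⊕ Fin s)) (α : Fin n → Bool) :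
    (P.snoc g).val α (Fin.last s) = g.eval (Sum.elim α (P.val α)) := by
  simp [val]

theorem val_snoc_castSucc (P : GateSeq n s) (g : Gate (Fin n ⊕ Fin s)) (α : Fin n → Bool)
    (j : Fin s) : (P.snoc g).val α j.castSucc = P.val α j := by
  simp [val]

theorem val_append_castAdd (P : GateSeq n s) (α : Fin n → Bool) {t : ℕ} (Q : GateSeq n t)
    (j : Fin s) : (P.append Q).val α (Fin.castAdd t j) = P.val α j := by
  induction Q with
  | nil => rfl
  | snoc Q g ih => exact (val_snoc_castSucc _ _ α _).trans ih

theorem val_append_natAdd (P : GateSeq n s) (α : Fin n → Bool) {t : ℕ} (Q : GateSeq n t)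
    (j : Fin t) : (P.append Q).val α (Fin.natAdd s j) = Q.val α j := by
  induction Q with
  | nil => exact j.elim0
  | snoc Q g ih =>
    refine Fin.lastCases ?_ (fun j => ?_) j
    · refine (val_snoc_last _ _ α).trans ?_
      rw [val_snoc_last, Gate.eval_map]
      congr 1
      funext w
      cases w with
      | inl i => rfl
      | inr j => exact ih j
    · refine (val_snoc_castSucc _ _ α (Fin.natAdd s j)).trans ?_
      rw [val_snoc_castSucc, ih]

end GateSeq

/-- The Boolean function `g` is computed by a circuit with at most `s` gates. -/
def HasCircuit {n : ℕ} (s : ℕ) (g : (Fin n → Bool) → Bool) : Prop :=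
  ∃ C : Circuit n, C.size ≤ s ∧ ∀ α, C.eval α = g α

namespace HasCircuit

variable {n s t : ℕ} {f g : (Fin n → Bool) → Bool}

theorem mono (hg : HasCircuit s g) (h : s ≤ t) : HasCircuit t g := by
  obtain ⟨C, h1, h2⟩ := hg
  exact ⟨C, h1.trans h, h2⟩

theorem input (i : Fin n) : HasCircuit 0 (fun α : Fin n → Bool => α i) :=
  ⟨⟨0, .nil, .inl i⟩, le_rfl, fun _ => rfl⟩

theorem const (b : Bool) : HasCircuit 1 (fun _ : Fin n → Bool => b) :=
  ⟨⟨1, .snoc .nil (.const b), .inr 0⟩, le_rfl, fun _ => rfl⟩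

theorem not (hg : HasCircuit s g) : HasCircuit (s + 1) (fun α => !g α) := by
  obtain ⟨C, h1, h2⟩ := hg
  refine ⟨⟨C.size + 1, .snoc C.gates (.not C.output), .inr (Fin.last _)⟩, by simpa using h1, ?_⟩
  intro α
  refine (GateSeq.val_snoc_last _ _ α).trans ?_
  simp only [← h2]
  rfl

/-- The two circuits are placed side by side without sharing, so sizes add. The operation `op` is
polymorphic because the type of wires depends on the number of gates. -/
theorem binary (op : ∀ {W : Type}, W → W → Gate W) (bop : Bool → Bool → Bool)
    (hop : ∀ {W : Type} (v : W → Bool) (a b : W), (op a b).eval v = bop (v a) (v b))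
    (hf : HasCircuit s f) (hg : HasCircuit t g) :
    HasCircuit (s + t + 1) (fun α => bop (f α) (g α)) := by
  obtain ⟨C, h1, h2⟩ := hf
  obtain ⟨D, h3, h4⟩ := hg
  refine ⟨⟨C.size + D.size + 1, .snoc (C.gates.append D.gates)
    (op (Sum.map id (Fin.castAdd _) C.output) (Sum.map id (Fin.natAdd _) D.output)),
    .inr (Fin.last _)⟩, ?_, ?_⟩
  · simp only
    omega
  · intro α
    refine (GateSeq.val_snoc_last _ _ α).trans ?_
    simp only [← h2, ← h4, hop]
    congr 1
    · unfold Circuit.eval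
      rcases C.output with i | j
      · rfl
      · exact GateSeq.val_append_castAdd _ _ _ _
    · unfold Circuit.eval
      rcases D.output with i | j
      · rfl
      · exact GateSeq.val_append_natAdd _ _ _ _

theorem and (hf : HasCircuit s f) (hg : HasCircuit t g) :
    HasCircuit (s + t + 1) (fun α => f α && g α) :=
  binary .and _ (fun _ _ _ => rfl) hf hg

theorem or (hf : HasCircuit s f) (hg : HasCircuit t g) :
    HasCircuit (s + t + 1) (fun α => f α || g α) :=
  binary .or _ (fun _ _ _ => rfl) hf hg

theorem all {ι : Type*} {g : ι → (Fin n → Bool) → Bool} (hg : ∀ i, HasCircuit s (g i))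
    (l : List ι) : HasCircuit (l.length * (s + 1) + 1) (fun α => l.all fun i => g i α) := by
  induction l with
  | nil => exact (const true).mono (by simp)
  | cons i l ih =>
    refine ((hg i).and ih).mono ?_
    rw [List.length_cons, add_one_mul]
    omega

theorem any {ι : Type*} {g : ι → (Fin n → Bool) → Bool} (hg : ∀ i, HasCircuit s (g i))
    (l : List ι) : HasCircuit (l.length * (s + 1) + 1) (fun α => l.any fun i => g i α) := by
  induction l with
  | nil => exact (const false).mono (by simp)
  | cons i l ih =>
    refine ((hg i).or ih).mono ?_
    rw [List.length_cons, add_one_mul]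
    omega

end HasCircuit

theorem permTest_eq_lists {m : ℕ} (A : Fin m → Fin m → Bool) : permTest A =
    (((List.finRange m).all fun i => (List.finRange m).any fun j => A i j) &&
      (List.finRange m).all fun i => (List.finRange m).all fun i' => (List.finRange m).all fun j =>
        decide (i = i') || !(A i j && A i' j)) := by
  rw [Bool.eq_iff_iff, permTest_eq_true]
  simp only [Bool.and_eq_true, List.all_eq_true, List.any_eq_true, List.mem_finRange, true_and,
    forall_const, Bool.or_eq_true, decide_eq_true_eq, Bool.not_eq_true', Bool.and_eq_false_iff]
  refine and_congr Iff.rfl (forall_congr' fun i => forall_congr' fun i' => forall_congr' fun j => ?_)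
  cases A i j <;> cases A i' j <;> simp

/-- The innermost test of two entries in a column costs four gates: a constant, a conjunction, a
negation and a disjunction. The triple conjunction over it gives the cubic term. -/
theorem hasCircuit_permTest {n m : ℕ} (e : Fin m → Fin m → Fin n) :
    HasCircuit (5 * m ^ 3 + 3 * m ^ 2 + 4 * m + 3)
      (fun α : Fin n → Bool => permTest fun i j => α (e i j)) := by
  simp only [permTest_eq_lists]
  have h1 := HasCircuit.all (fun i : Fin m => HasCircuit.any
    (fun j => HasCircuit.input (e i j)) (List.finRange m)) (List.finRange m)
  have h2 := HasCircuit.all (fun i : Fin m => HasCircuit.all (fun i' : Fin m => HasCircuit.all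
    (fun j => (HasCircuit.const (n := n) (decide (i = i'))).or
      ((HasCircuit.input (e i j)).and (HasCircuit.input (e i' j))).not)
    (List.finRange m)) (List.finRange m)) (List.finRange m)
  refine (h1.and h2).mono ?_
  simp only [List.length_finRange]
  exact le_of_eq (by ring)

/-! ### The Tseitin encoding -/

/-- The number of clauses plus the number of literal occurrences. -/
def clauseWeight {V : Type} (F : Finset (Clause V)) : ℕ := ∑ C ∈ F, (C.card + 1)

theorem clauseWeight_union_le {V : Type} [DecidableEq V] (F G : Finset (Clause V)) :
    clauseWeight (F ∪ G) ≤ clauseWeight F + clauseWeight G := by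
  unfold clauseWeight
  rw [← Finset.sum_union_inter]
  exact Nat.le_add_right _ _

theorem clauseWeight_le {V : Type} {F : Finset (Clause V)} {a b : ℕ} (hF : F.card ≤ a)
    (hC : ∀ C ∈ F, C.card ≤ b) : clauseWeight F ≤ a * (b + 1) :=
  (Finset.sum_le_card_nsmul _ _ (b + 1) fun C h => Nat.succ_le_succ (hC C h)).trans
    (Nat.mul_le_mul_right _ hF)

/-- A crude count: at most three clauses of at most three literals, so 3 · (3 + 1). -/
theorem Gate.clauseWeight_tseitin_le {n s : ℕ} (z : EncVar n) (g : Gate (Fin n ⊕ Fin s)) :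
    clauseWeight (g.tseitin z) ≤ 12 := by
  refine clauseWeight_le (a := 3) (b := 3) ?_ ?_
  · cases g
    · simp [tseitin]
    · exact Finset.card_le_two.trans (by norm_num)
    · exact Finset.card_le_three
    · exact Finset.card_le_three
  · intro C hC
    cases g <;> simp only [tseitin, Finset.mem_insert, Finset.mem_singleton] at hC
    · simp [hC]
    · rcases hC with rfl | rfl <;> exact Finset.card_le_two.trans (by norm_num)
    · rcases hC with rfl | rfl | rfl
      · exact Finset.card_le_two.trans (by norm_num)
      · exact Finset.card_le_two.trans (by norm_num)
      · exact Finset.card_le_three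
    · rcases hC with rfl | rfl | rfl
      · exact Finset.card_le_two.trans (by norm_num)
      · exact Finset.card_le_two.trans (by norm_num)
      · exact Finset.card_le_three

theorem GateSeq.clauseWeight_tseitin_le {n s : ℕ} (P : GateSeq n s) :
    clauseWeight P.tseitin ≤ 12 * s := by
  induction P with
  | nil => simp [GateSeq.tseitin, clauseWeight]
  | @snoc s P g ih =>
    have h1 := clauseWeight_union_le P.tseitin (g.tseitin (.y s))
    have h2 := g.clauseWeight_tseitin_le (.y s)
    rw [GateSeq.tseitin]
    omega

/-- Each gate costs one variable and clause weight 12; the 7 is `u` together with the two output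
clauses of weight 3 each. -/
theorem Circuit.size_toQBF_le {n : ℕ} (C : Circuit n) : C.toQBF.size ≤ n + 13 * C.size + 7 := by
  have h1 := C.gates.clauseWeight_tseitin_le
  have h2 : clauseWeight ({{(wireVar C.output, true), (.u, true)},
      {(wireVar C.output, false), (.u, false)}} : Finset (Clause (EncVar n))) ≤ 2 * (2 + 1) := by
    refine clauseWeight_le Finset.card_le_two ?_
    intro D hD
    simp only [Finset.mem_insert, Finset.mem_singleton] at hD
    rcases hD with rfl | rfl <;> exact Finset.card_le_two
  have h3 : clauseWeight C.toQBF.matrix ≤ _ := clauseWeight_union_le C.gates.tseitin _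
  have h4 : (C.toQBF.blocks.map (fun B => B.2.card)).sum ≤ n + 1 + C.size := by
    have hx : (Finset.univ.image (EncVar.x (n := n))).card ≤ n :=
      Finset.card_image_le.trans (by simp)
    have hy : ((Finset.range C.size).image (EncVar.y (n := n))).card ≤ C.size :=
      Finset.card_image_le.trans (by simp)
    simp only [Circuit.toQBF, List.map_cons, List.map_nil, List.sum_cons, List.sum_nil,
      Finset.card_singleton]
    omega
  have h5 : C.toQBF.size = (C.toQBF.blocks.map (fun B => B.2.card)).sum +
    clauseWeight C.toQBF.matrix := rfl
  omega

theorem Gate.not_falsified_tseitin {n s : ℕ} {z : EncVar n} {g : Gate (Fin n ⊕ Fin s)}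
    {β : EncVar n → Bool} (hz : β z = g.eval fun w => β (wireVar w)) :
    ∀ A ∈ g.tseitin z, ¬Clause.Falsified β A := by
  intro A hA hF
  cases g <;> simp only [tseitin, Finset.mem_insert, Finset.mem_singleton] at hA <;>
    simp only [Gate.eval] at hz
  · subst hA
    exact hF _ (Finset.mem_singleton_self _) hz
  all_goals
    rcases hA with rfl | rfl | rfl <;>
    simp only [Clause.Falsified, Finset.mem_insert, Finset.mem_singleton, forall_eq_or_imp,
      forall_eq] at hF <;> simp_all

theorem GateSeq.not_falsified_tseitin {n s : ℕ} (P : GateSeq n s) {β : EncVar n → Bool}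
    (hy : ∀ j : Fin s, β (.y j) = P.val (fun i => β (.x i)) j) :
    ∀ A ∈ P.tseitin, ¬Clause.Falsified β A := by
  induction P with
  | nil => simp [GateSeq.tseitin]
  | @snoc s P g ih =>
    have hy' : ∀ j : Fin s, β (.y j) = P.val (fun i => β (.x i)) j := by
      intro j
      have := hy j.castSucc
      rwa [val_snoc_castSucc] at this
    intro A hA
    rcases Finset.mem_union.1 hA with h | h
    · exact ih hy' A h
    · refine Gate.not_falsified_tseitin ?_ A h
      have := hy (Fin.last s)
      rw [val_snoc_last] at this
      refine this.trans (congrArg (fun v => g.eval v) ?_)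
      funext w
      cases w with
      | inl i => rfl
      | inr j => exact (hy' j).symm

/-- With correct gate values no gate clause fails, and an output clause fails only if `u` equals the
output. -/
theorem Circuit.eq_eval_of_falsified {n : ℕ} (C : Circuit n) {β : EncVar n → Bool}
    (hy : ∀ j : Fin C.size, β (.y j) = C.gates.val (fun i => β (.x i)) j)
    {A : Clause (EncVar n)} (hA : A ∈ C.tseitin) (hF : Clause.Falsified β A) :
    β .u = C.eval fun i => β (.x i) := by
  have ho : β (wireVar C.output) = C.eval fun i => β (.x i) := by
    unfold Circuit.eval
    rcases C.output with i | j
    · rfl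
    · exact hy j
  rcases Finset.mem_union.1 hA with h | h
  · exact absurd hF (C.gates.not_falsified_tseitin hy A h)
  · simp only [Finset.mem_insert, Finset.mem_singleton] at h
    rw [← ho]
    rcases h with rfl | rfl <;>
    simp only [Clause.Falsified, Finset.mem_insert, Finset.mem_singleton, forall_eq_or_imp,
      forall_eq] at hF <;> simp_all

/-! ### Strategy extraction for circuit encodings -/

namespace Circuit

variable {n : ℕ} (C : Circuit n)

theorem u_mem_univVars_toQBF : EncVar.u ∈ C.toQBF.univVars := by
  simp [QBF.univVars, QBF.varsOf, toQBF]

theorem u_notMem_existVars_toQBF : EncVar.u ∉ C.toQBF.existVars := by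
  simp [QBF.existVars, QBF.varsOf, toQBF]

theorem exists_of_precedes_u {v : EncVar n} (h : C.toQBF.Precedes v .u) : ∃ i, v = .x i := by
  obtain ⟨i, j, hij, hv, hu⟩ := h
  change Fin 3 at i j
  fin_cases i <;> fin_cases j <;> simp_all [toQBF]
  exact ⟨_, hv.choose_spec.symm⟩

theorem mem_existVars_or_eq_u {A : Clause (EncVar n)} (hA : A ∈ C.toQBF.matrix)
    {l : Lit (EncVar n)} (hl : l ∈ A) : l.1 ∈ C.toQBF.existVars ∨ l.1 = .u := by
  obtain ⟨B, hB, hlB⟩ := C.toQBF.closed A hA l hl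
  simp only [toQBF, List.mem_cons, List.not_mem_nil, or_false] at hB
  rcases hB with rfl | rfl | rfl
  · left
    simp [QBF.existVars, QBF.varsOf, toQBF] at hlB ⊢
    exact .inl hlB
  · right
    simpa using hlB
  · left
    simp [QBF.existVars, QBF.varsOf, toQBF] at hlB ⊢
    exact .inr hlB

/-- The final merge map of a refutation of the encoding computes the encoded function. -/
theorem map_last_computes (R : MResRefutation C.toQBF) (u : C.toQBF.univVars)
    (hu : (u : EncVar n) = .u) (γ : EncVar n → Bool) (τ : List (EncVar n × Bool)) (j : ℕ)
    (o : Option Bool)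
    (w : ((R.line (Fin.last _)).map u).Walk ((R.line (Fin.last _)).map u).top τ j)
    (ho : ((R.line (Fin.last _)).map u).instr j = some (.out o)) (hτ : ∀ p ∈ τ, γ p.1 = p.2) :
    o = some (C.eval fun i => γ (.x i)) := by
  let α : EncVar n → Bool := fun v => match v with
    | .x i => γ (.x i)
    | .u => false
    | .y j => if h : j < C.size then C.gates.val (fun i => γ (.x i)) ⟨j, h⟩ else false
  have hα : ∀ p ∈ τ, α p.1 = p.2 := by
    intro p hp
    have hS := w.var_mem p hp
    simp only [QBF.left, Finset.mem_filter] at hS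
    rw [hu] at hS
    obtain ⟨i, hi⟩ := C.exists_of_precedes_u hS.2
    rw [← hτ p hp, hi]
  have key : ∀ b, (o = none ∨ o = some b) → b = C.eval fun i => γ (.x i) := by
    intro b hb
    have hnot : (u : EncVar n) ∉ C.toQBF.existVars := hu ▸ C.u_notMem_existVars_toQBF
    obtain ⟨A, hA, hF⟩ := R.sound u hnot
      (fun A hA l hl => by rw [hu]; exact C.mem_existVars_or_eq_u hA hl) (Fin.last _) α b τ j o
      (by rw [R.last_empty]; simp [Clause.Falsified]) w ho hα hb
    rw [hu] at hF
    have := C.eq_eval_of_falsified (by intro j; simp [α]) hA hF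
    simpa [α] using this
  cases o with
  | some b => rw [key b (.inr rfl)]
  -- An output `*` would be compatible with both values of `u`, so both would equal the output of
  -- the circuit.
  | none =>
    have h1 := key false (.inl rfl)
    have h2 := key true (.inl rfl)
    simp [← h1] at h2

end Circuit

/-! ### Storing the matrix in the input bits, numerical bounds and conclusion -/

/-- The position of an entry of an `m × m` matrix stored row by row. -/
def entryIndex {n m : ℕ} (h : m * m ≤ n) (i j : Fin m) : Fin n :=
  ⟨m * i + j, by
    have h1 : m * (i + 1) ≤ m * m := Nat.mul_le_mul_left m i.isLt
    have h2 := j.isLt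
    rw [mul_add_one] at h1
    omega⟩

theorem entryIndex_inj {n m : ℕ} (h : m * m ≤ n) {i j i' j' : Fin m}
    (he : entryIndex h i j = entryIndex h i' j') : i = i' ∧ j = j' := by
  have hv : m * (i : ℕ) + j = m * i' + j' := congrArg Fin.val he
  have hpos : 0 < m := j.pos
  have hi : (i : ℕ) = i' := by
    have := congrArg (· / m) hv
    simpa [Nat.mul_add_div hpos, Nat.div_eq_of_lt] using this
  refine ⟨Fin.ext hi, Fin.ext ?_⟩
  rw [hi] at hv
  omega

/-- The ratio of consecutive central binomial coefficients is 2(2h + 1)/(h + 1) ≥ 2. -/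
theorem two_pow_le_centralBinom (h : ℕ) : 2 ^ h ≤ h.centralBinom := by
  induction h with
  | zero => simp
  | succ h ih =>
    have h1 := Nat.succ_mul_centralBinom_succ h
    have h2 : (h + 1) * (2 * h.centralBinom) ≤ (h + 1) * (h + 1).centralBinom := by
      rw [h1]
      nlinarith [Nat.zero_le h.centralBinom, Nat.zero_le (h * h.centralBinom)]
    have h3 := Nat.le_of_mul_le_mul_left h2 (Nat.succ_pos h)
    rw [pow_succ]
    omega

/-- Half of the side length of the matrix stored in `n` input bits. -/
def halfSide (n : ℕ) : ℕ := n.sqrt / 2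

theorem halfSide_sq_le (n : ℕ) : 2 * halfSide n * (2 * halfSide n) ≤ n := by
  have h : 2 * halfSide n ≤ n.sqrt := by unfold halfSide; omega
  exact (Nat.mul_le_mul h h).trans (Nat.sqrt_le n)

/-- The two roundings give √n < 2 `halfSide n` + 2, so `halfSide n` > √n/2 - 1, which is at least
√n/4 once √n ≥ 4. -/
theorem sqrt_le_halfSide {n : ℕ} (hn : 16 ≤ n) : 1 / 4 * Real.sqrt n ≤ halfSide n := by
  have h1 : Real.sqrt n < n.sqrt + 1 := Real.real_sqrt_lt_nat_sqrt_succ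
  have h2 : (4 : ℝ) ≤ Real.sqrt n := Real.le_sqrt_of_sq_le (by norm_num; exact_mod_cast hn)
  have h3 : n.sqrt ≤ 2 * halfSide n + 1 := by unfold halfSide; omega
  have h4 : (n.sqrt : ℝ) ≤ 2 * halfSide n + 1 := by exact_mod_cast h3
  linarith

theorem Circuit.two_pow_le_size {n : ℕ} (C : Circuit n)
    (hC : ∀ α, C.eval α = permTest fun i j => α (entryIndex (halfSide_sq_le n) i j))
    (R : MResRefutation C.toQBF) (hR : R.IsRegular) : 2 ^ halfSide n ≤ R.size := by
  let u : C.toQBF.univVars := ⟨.u, C.u_mem_univVars_toQBF⟩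
  refine (two_pow_le_centralBinom _).trans (le_trans ?_ (R.card_dom_le u (Fin.last _)))
  rw [Nat.centralBinom]
  refine MergeMap.choose_le_card_dom (e := fun i j => .x (entryIndex (halfSide_sq_le n) i j))
    (by omega) ?_ (fun τ j w => hR.nodup_walk u w) ?_
  · intro i j i' j' h
    exact entryIndex_inj _ (EncVar.x.inj h)
  · intro γ τ j o w ho hτ
    rw [C.map_last_computes R u rfl γ τ j o w ho hτ, hC]

theorem corollary3p10 :
    ∃ (f : ∀ n : ℕ, (Fin n → Bool) → Bool) (Φ : ∀ n : ℕ, QBF (EncVar n)),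
      (∀ n, IsQBFEncoding (f n) (Φ n)) ∧
      (∃ p : Polynomial ℕ, ∀ n, (Φ n).size ≤ p.eval n) ∧
      (∃ c : ℝ, 0 < c ∧ ∀ᶠ n : ℕ in Filter.atTop,
        ∀ R : MResRefutation (Φ n), R.IsRegular →
          (2 : ℝ) ^ (c * Real.sqrt (n : ℝ)) ≤ (R.size : ℝ)) := by
  choose C hsize hC using fun n : ℕ => hasCircuit_permTest (entryIndex (halfSide_sq_le n))
  refine ⟨fun n α => permTest fun i j => α (entryIndex (halfSide_sq_le n) i j),
    fun n => (C n).toQBF, fun n => ⟨C n, hC n, rfl⟩, ?_, 1 / 4, by norm_num, ?_⟩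
  -- The size bound n + 13s + 7 of the encoding, with s the circuit bound for a matrix of side 2
  -- `halfSide n` ≤ n.
  · refine ⟨.X + 13 * (5 * .X ^ 3 + 3 * .X ^ 2 + 4 * .X + 3) + 7, fun n => ?_⟩
    have hm : 2 * halfSide n ≤ n := (Nat.le_mul_self _).trans (halfSide_sq_le n)
    have hle : 5 * (2 * halfSide n) ^ 3 + 3 * (2 * halfSide n) ^ 2 + 4 * (2 * halfSide n) + 3 ≤
        5 * n ^ 3 + 3 * n ^ 2 + 4 * n + 3 := by gcongr
    refine (C n).size_toQBF_le.trans ?_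
    have := (hsize n).trans hle
    simp only [Polynomial.eval_add, Polynomial.eval_mul, Polynomial.eval_pow, Polynomial.eval_X,
      Polynomial.eval_ofNat]
    omega
  · filter_upwards [Filter.eventually_ge_atTop 16] with n hn R hR
    calc (2 : ℝ) ^ (1 / 4 * Real.sqrt (n : ℝ)) ≤ (2 : ℝ) ^ (halfSide n : ℝ) :=
          Real.rpow_le_rpow_of_exponent_le (by norm_num) (sqrt_le_halfSide hn)
      _ = ((2 ^ halfSide n : ℕ) : ℝ) := by rw [Real.rpow_natCast]; norm_cast
      _ ≤ R.size := by exact_mod_cast (C n).two_pow_le_size (hC n) R hR
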